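/- Let $Q$ be a quantum system with finite-dimensional Hilbert space $\mathbb{C}^d$. A state of $Q$ is a positive semidefinite operator $\gamma$ with $\operatorname{Tr}\gamma=1$; its von Neumann entropy is $H(\gamma)=-\operatorname{Tr}\{\gamma\log_2\gamma\}=-\sum_i\lambda_i\log_2\lambda_i$, where the $\lambda_i$ are the eigenvalues of $\gamma$ with multiplicity and $0\log_2 0=0$. A POVM on $Q$ with finite outcome set $\mathcal X$ is a family $M=\{M_x\}_{x\in\mathcal X}$ of positive semidefinite operators with $\sum_{x\in\mathcal X}M_x=\mathbb 1$. For a state $\gamma$ and POVMs $M=\{M_x\}_{x\in\mathcal X}$ and $N=\{N_y\}_{y\in\mathcal Y}$ on $Q$, consider on $\mathcal X\times\mathcal Y$ the joint probability distribution $$\Pr\{y\leftarrow x\}=\operatorname{Tr}\{N_y\sqrt{\gamma}\,M_x\sqrt{\gamma}\},$$ which is symmetric under exchanging the roles of $M$ and $N$. The mutual retrodictability $R(M;N)_\gamma$ is its classical mutual information $$R(M;N)_\gamma = I(X;Y)=H(X)+H(Y)-H(XY),$$ where $H(X)$, $H(Y)$, $H(XY)$ are the Shannon entropies (base-$2$ logarithm,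 $0\log_2 0=0$) of the two marginals and of the joint distribution. Theorem. For every state $\gamma$ and every pair of POVMs $M$, $N$ (with finite outcome sets) on $Q$, $$0\le R(M;N)_\gamma\le H(\gamma).$$ -/

import Mathlib

open scoped ComplexOrder MatrixOrder

/-- A state (density operator) of a finite-dimensional quantum system with Hilbert space `ℂ^d`:
a positive semidefinite matrix of unit trace. -/
structure QState (d : Type*) [Fintype d] where
  mat : Matrix d d ℂ
  posSemidef : mat.PosSemidef
  trace_eq_one : mat.trace = 1

/-- A POVM with finite outcome set `X` on `ℂ^d`: positive semidefinite matrices that sum to the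
identity. -/
structure POVM (X d : Type*) [Fintype X] [Fintype d] [DecidableEq d] where
  elem : X → Matrix d d ℂ
  posSemidef : ∀ x, (elem x).PosSemidef
  sum_eq_one : ∑ x, elem x = 1

/-- Shannon entropy, in bits, of a finite family of weights: `-∑ p log₂ p` with `0 log₂ 0 = 0`. -/
noncomputable def shannonEntropy {ι : Type*} [Fintype ι] (p : ι → ℝ) : ℝ :=
  -∑ i, p i * Real.logb 2 (p i)

/-- Classical mutual information `I(X;Y) = H(X) + H(Y) - H(XY)`, in bits, of a joint
distribution on `X × Y`. -/
noncomputable def mutualInformation {X Y : Type*} [Fintype X] [Fintype Y]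
    (p : X × Y → ℝ) : ℝ :=
  shannonEntropy (fun x => ∑ y, p (x, y)) + shannonEntropy (fun y => ∑ x, p (x, y))
    - shannonEntropy p

/-- Von Neumann entropy `H(γ) = -Tr (γ log₂ γ)`: the Shannon entropy of the eigenvalues of `γ`,
counted with multiplicity. -/
noncomputable def vonNeumannEntropy {d : Type*} [Fintype d] [DecidableEq d] (γ : QState d) : ℝ :=
  shannonEntropy γ.posSemidef.isHermitian.eigenvalues

/-- The retrodictive joint probability `Pr{y ← x} = Tr (N_y √γ M_x √γ)`, as a function of the
pair `(x, y)`. The trace is a nonnegative real, see `retroJoint_ofReal`. -/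
noncomputable def retroJoint {d X Y : Type*} [Fintype d] [DecidableEq d] [Fintype X] [Fintype Y]
    (γ : QState d) (M : POVM X d) (N : POVM Y d) : X × Y → ℝ := fun q =>
  (N.elem q.2 * CFC.sqrt γ.mat * M.elem q.1 * CFC.sqrt γ.mat).trace.re

/-- The mutual retrodictability `R(M;N)_γ`. -/
noncomputable def mutualRetrodictability {d X Y : Type*} [Fintype d] [DecidableEq d]
    [Fintype X] [Fintype Y] (γ : QState d) (M : POVM X d) (N : POVM Y d) : ℝ :=
  mutualInformation (retroJoint γ M N)

theorem QState.sqrt_mul_sqrt {d : Type*} [Fintype d] [DecidableEq d] (γ : QState d) :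
    CFC.sqrt γ.mat * CFC.sqrt γ.mat = γ.mat :=
  CFC.sqrt_mul_sqrt_self γ.mat γ.posSemidef.nonneg

theorem retroJoint_trace_nonneg {d X Y : Type*} [Fintype d] [DecidableEq d]
    [Fintype X] [Fintype Y] (γ : QState d) (M : POVM X d) (N : POVM Y d) (x : X) (y : Y) :
    0 ≤ (N.elem y * CFC.sqrt γ.mat * M.elem x * CFC.sqrt γ.mat).trace := by
  have hs : (CFC.sqrt γ.mat).IsHermitian :=
    (Matrix.nonneg_iff_posSemidef.mp (CFC.sqrt_nonneg γ.mat)).isHermitian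
  have ht : (CFC.sqrt (N.elem y)).IsHermitian :=
    (Matrix.nonneg_iff_posSemidef.mp (CFC.sqrt_nonneg (N.elem y))).isHermitian
  have hN : CFC.sqrt (N.elem y) * CFC.sqrt (N.elem y) = N.elem y :=
    CFC.sqrt_mul_sqrt_self _ (N.posSemidef y).nonneg
  have h := ((M.posSemidef x).mul_mul_conjTranspose_same
    (CFC.sqrt (N.elem y) * CFC.sqrt γ.mat)).trace_nonneg
  rw [Matrix.conjTranspose_mul, hs.eq, ht.eq] at h
  have e : (N.elem y * CFC.sqrt γ.mat * M.elem x * CFC.sqrt γ.mat).trace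
      = (CFC.sqrt (N.elem y) * CFC.sqrt γ.mat * M.elem x
        * (CFC.sqrt γ.mat * CFC.sqrt (N.elem y))).trace := by
    conv_lhs => rw [← hN]
    simp only [Matrix.mul_assoc]
    rw [Matrix.trace_mul_comm]
    simp only [Matrix.mul_assoc]
  rw [e]
  exact h

/-- Taking the real part in `retroJoint` loses nothing. -/
theorem retroJoint_ofReal {d X Y : Type*} [Fintype d] [DecidableEq d]
    [Fintype X] [Fintype Y] (γ : QState d) (M : POVM X d) (N : POVM Y d) (x : X) (y : Y) :
    ((retroJoint γ M N (x, y) : ℝ) : ℂ)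
      = (N.elem y * CFC.sqrt γ.mat * M.elem x * CFC.sqrt γ.mat).trace :=
  (Complex.eq_re_of_ofReal_le (r := 0)
    (by simpa using retroJoint_trace_nonneg γ M N x y)).symm

/-- `Pr{y ← x}` is symmetric under the exchange of the two POVMs. -/
theorem retroJoint_symm {d X Y : Type*} [Fintype d] [DecidableEq d]
    [Fintype X] [Fintype Y] (γ : QState d) (M : POVM X d) (N : POVM Y d) (x : X) (y : Y) :
    retroJoint γ M N (x, y) = retroJoint γ N M (y, x) := by
  simp only [retroJoint]
  rw [Matrix.mul_assoc (N.elem y * _), Matrix.trace_mul_comm]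
  simp only [Matrix.mul_assoc]

/-- The first marginal is the Born rule for `M`. -/
theorem retroJoint_marginal {d X Y : Type*} [Fintype d] [DecidableEq d]
    [Fintype X] [Fintype Y] (γ : QState d) (M : POVM X d) (N : POVM Y d) (x : X) :
    ∑ y, retroJoint γ M N (x, y) = (M.elem x * γ.mat).trace.re := by
  simp only [retroJoint]
  rw [← Complex.re_sum, ← Matrix.trace_sum]
  simp only [Matrix.mul_assoc]
  rw [← Finset.sum_mul, N.sum_eq_one, one_mul, Matrix.trace_mul_comm, Matrix.mul_assoc,
    γ.sqrt_mul_sqrt]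

/-- `Pr{y ← x}` is a probability distribution on `X × Y`. -/
theorem retroJoint_mem_stdSimplex {d X Y : Type*} [Fintype d] [DecidableEq d]
    [Fintype X] [Fintype Y] (γ : QState d) (M : POVM X d) (N : POVM Y d) :
    retroJoint γ M N ∈ stdSimplex ℝ (X × Y) := by
  refine ⟨fun q => (Complex.le_def.mp (retroJoint_trace_nonneg γ M N q.1 q.2)).1, ?_⟩
  rw [Fintype.sum_prod_type]
  simp only [retroJoint_marginal]
  rw [← Complex.re_sum, ← Matrix.trace_sum, ← Finset.sum_mul, M.sum_eq_one, one_mul,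
    γ.trace_eq_one, Complex.one_re]

/-! With p the joint distribution and r = p_X p_Y / p, the lower bound is Gibbs' inequality, from
log u ≤ u - 1. The upper bound says that ∑ l log l ≤ ∑ p log r, where l is the spectrum of γ.

Logarithms are traded for resolvents: F(s) = ∑ l log(l+s) - ∑ p log(r+s) has an upper bound tending
to 0 as s → ∞, so F(0) ≤ 0 once F is nondecreasing, i.e. once ∑ p/(r+s) ≤ ∑ l/(l+s) for s > 0
(`sum_mul_log_le_of_resolvent_le`).

For that, split γ = ∑ W_x with W_x = √γ M_x √γ, and let R = (γ+s)⁻¹, so that ∑ l/(l+s) = ∑ Tr(W_x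
R). It suffices to bound each x separately (`POVM.sum_sq_div_le`). There p²/D is the maximum of 2tp
- t²D, and the maximizers t_y are assembled into A = ∑ t_y N_y. Kadison's inequality A² ≤ ∑ t_y²
N_y, the bound W ≤ (Tr W)·1, and the operator square 2A - A(γ+s)A ≤ R finish the estimate. -/

/-! ### Trace inequalities and the resolvent of a positive semidefinite matrix. -/

section TraceInequalities

variable {d : Type*} [Fintype d]

/-- The trace of a product of two positive semidefinite matrices has nonnegative real part. -/
theorem Matrix.PosSemidef.re_trace_mul_nonneg {A B : Matrix d d ℂ}
    (hA : A.PosSemidef) (hB : B.PosSemidef) : 0 ≤ (A * B).trace.re := by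
  classical
  have ht : (CFC.sqrt A).IsHermitian :=
    (Matrix.nonneg_iff_posSemidef.mp (CFC.sqrt_nonneg A)).isHermitian
  have hs : CFC.sqrt A * CFC.sqrt A = A := CFC.sqrt_mul_sqrt_self _ hA.nonneg
  have h := (hB.mul_mul_conjTranspose_same (CFC.sqrt A)).trace_nonneg
  rw [ht.eq, Matrix.trace_mul_comm, ← Matrix.mul_assoc, hs] at h
  exact (Complex.le_def.mp h).1

variable [DecidableEq d]

/-- A positive semidefinite matrix is dominated by its trace times the identity. -/
theorem Matrix.PosSemidef.trace_smul_one_sub {W : Matrix d d ℂ} (hW : W.PosSemidef) :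
    (((W.trace.re : ℝ) : ℂ) • (1 : Matrix d d ℂ) - W).PosSemidef := by
  set U : Matrix d d ℂ := (hW.isHermitian.eigenvectorUnitary : Matrix d d ℂ) with hU
  have hUU : U * star U = 1 := Unitary.mul_star_self_of_mem hW.isHermitian.eigenvectorUnitary.2
  have hs : W = U * Matrix.diagonal (fun i => (hW.isHermitian.eigenvalues i : ℂ)) * star U := by
    conv_lhs => rw [hW.isHermitian.spectral_theorem]
    rfl
  have ht : W.trace.re = ∑ i, hW.isHermitian.eigenvalues i := by
    rw [hW.isHermitian.trace_eq_sum_eigenvalues]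
    simp
  have e : ((W.trace.re : ℝ) : ℂ) • (1 : Matrix d d ℂ) - W
      = U * Matrix.diagonal
          (fun i => ((W.trace.re - hW.isHermitian.eigenvalues i : ℝ) : ℂ)) * star U := by
    have hd : Matrix.diagonal
          (fun i => ((W.trace.re - hW.isHermitian.eigenvalues i : ℝ) : ℂ))
        = ((W.trace.re : ℝ) : ℂ) • (1 : Matrix d d ℂ)
          - Matrix.diagonal (fun i => (hW.isHermitian.eigenvalues i : ℂ)) := by
      ext i j
      by_cases hij : i = j <;> simp [hij]
    rw [hd, mul_sub, sub_mul, ← hs, Matrix.mul_smul, Matrix.smul_mul, mul_one, hUU]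
  rw [e]
  refine Matrix.PosSemidef.mul_mul_conjTranspose_same
    (Matrix.PosSemidef.diagonal fun i => ?_) U
  rw [Pi.zero_apply, Complex.zero_le_real, ht]
  exact sub_nonneg.mpr (Finset.single_le_sum
    (fun j _ => hW.eigenvalues_nonneg j) (Finset.mem_univ i))

/-- The trace is submultiplicative on positive semidefinite matrices. -/
theorem Matrix.PosSemidef.re_trace_mul_le {W K : Matrix d d ℂ}
    (hW : W.PosSemidef) (hK : K.PosSemidef) :
    (W * K).trace.re ≤ W.trace.re * K.trace.re := by
  have h := hW.trace_smul_one_sub.re_trace_mul_nonneg hK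
  rw [sub_mul, Matrix.smul_mul, one_mul, Matrix.trace_sub, Matrix.trace_smul, Complex.sub_re,
    smul_eq_mul, Complex.re_ofReal_mul] at h
  linarith

/-- The resolvent of a positive semidefinite matrix at `-s`, and its trace against the matrix. -/
theorem Matrix.PosSemidef.exists_resolvent {γ : Matrix d d ℂ} (hγ : γ.PosSemidef) {s : ℝ}
    (hs : 0 < s) : ∃ R : Matrix d d ℂ, R.IsHermitian ∧ (γ + (s : ℂ) • 1) * R = 1 ∧
      R * (γ + (s : ℂ) • 1) = 1 ∧
      (γ * R).trace.re
        = ∑ i, hγ.isHermitian.eigenvalues i / (hγ.isHermitian.eigenvalues i + s) := by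
  set l := hγ.isHermitian.eigenvalues with hl
  have hpos : ∀ i, 0 < l i + s := fun i => add_pos_of_nonneg_of_pos (hγ.eigenvalues_nonneg i) hs
  set U : Matrix d d ℂ := (hγ.isHermitian.eigenvectorUnitary : Matrix d d ℂ) with hU
  have hUU : U * star U = 1 := Unitary.mul_star_self_of_mem hγ.isHermitian.eigenvectorUnitary.2
  have hUU' : star U * U = 1 := Unitary.star_mul_self_of_mem hγ.isHermitian.eigenvectorUnitary.2
  have hsp : γ = U * Matrix.diagonal (fun i => (l i : ℂ)) * star U := by
    conv_lhs => rw [hγ.isHermitian.spectral_theorem]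
    rfl
  have conj_mul : ∀ A B : Matrix d d ℂ,
      (U * A * star U) * (U * B * star U) = U * (A * B) * star U := fun A B => by
    calc _ = U * A * (star U * U) * B * star U := by simp only [Matrix.mul_assoc]
      _ = _ := by rw [hUU']; simp only [Matrix.mul_assoc, Matrix.one_mul]
  have hG : γ + (s : ℂ) • 1 = U * Matrix.diagonal (fun i => ((l i + s : ℝ) : ℂ)) * star U := by
    have hd : Matrix.diagonal (fun i => ((l i + s : ℝ) : ℂ))
        = Matrix.diagonal (fun i => (l i : ℂ)) + (s : ℂ) • (1 : Matrix d d ℂ) := by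
      ext i j
      by_cases hij : i = j <;> simp [hij]
    rw [hd, mul_add, add_mul, ← hsp, Matrix.mul_smul, Matrix.smul_mul, mul_one, hUU]
  have hne : ∀ i, ((l i + s : ℝ) : ℂ) ≠ 0 := fun i => Complex.ofReal_ne_zero.mpr (hpos i).ne'
  refine ⟨U * Matrix.diagonal (fun i => (((l i + s)⁻¹ : ℝ) : ℂ)) * star U, ?_, ?_, ?_, ?_⟩
  · refine Matrix.isHermitian_mul_mul_conjTranspose U ?_
    exact Matrix.isHermitian_diagonal_of_self_adjoint _ (by ext i; simp)
  · rw [hG, conj_mul, Matrix.diagonal_mul_diagonal]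
    have : (fun i => ((l i + s : ℝ) : ℂ) * (((l i + s)⁻¹ : ℝ) : ℂ)) = fun _ => 1 := by
      funext i
      rw [← Complex.ofReal_mul, mul_inv_cancel₀ (hpos i).ne', Complex.ofReal_one]
    rw [this, Matrix.diagonal_one, mul_one, hUU]
  · rw [hG, conj_mul, Matrix.diagonal_mul_diagonal]
    have : (fun i => (((l i + s)⁻¹ : ℝ) : ℂ) * ((l i + s : ℝ) : ℂ)) = fun _ => 1 := by
      funext i
      rw [← Complex.ofReal_mul, inv_mul_cancel₀ (hpos i).ne', Complex.ofReal_one]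
    rw [this, Matrix.diagonal_one, mul_one, hUU]
  · conv_lhs => rw [hsp]
    rw [conj_mul, Matrix.diagonal_mul_diagonal, Matrix.trace_mul_comm, ← Matrix.mul_assoc, hUU',
      one_mul, Matrix.trace_diagonal, Complex.re_sum]
    refine Finset.sum_congr rfl fun i _ => ?_
    rw [← Complex.ofReal_mul, Complex.ofReal_re, div_eq_mul_inv]

end TraceInequalities

/-! ### Operator inequalities for a single measurement. -/

section Measurement

variable {d X Y : Type*} [Fintype d] [DecidableEq d] [Fintype X] [Fintype Y]

/-- Kadison's inequality for a real linear combination of the elements of a POVM. -/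
theorem POVM.posSemidef_sum_sq_sub (N : POVM Y d) (t : Y → ℝ) :
    (∑ y, ((t y ^ 2 : ℝ) : ℂ) • N.elem y
      - (∑ y, (t y : ℂ) • N.elem y) * ∑ y, (t y : ℂ) • N.elem y).PosSemidef := by
  set A := ∑ y, (t y : ℂ) • N.elem y with hA
  have hAh : A.conjTranspose = A := by
    simp [hA, Matrix.conjTranspose_sum, Matrix.conjTranspose_smul, (N.posSemidef _).isHermitian.eq]
  -- The defect is an operator variance, the sum of (t_y - A) N_y (t_y - A)*.
  have e : ∑ y, ((t y ^ 2 : ℝ) : ℂ) • N.elem y - A * A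
      = ∑ y, ((t y : ℂ) • (1 : Matrix d d ℂ) - A) * N.elem y
          * ((t y : ℂ) • (1 : Matrix d d ℂ) - A).conjTranspose := by
    have key : ∀ y, ((t y : ℂ) • (1 : Matrix d d ℂ) - A) * N.elem y
          * ((t y : ℂ) • (1 : Matrix d d ℂ) - A).conjTranspose
        = ((t y ^ 2 : ℝ) : ℂ) • N.elem y - A * ((t y : ℂ) • N.elem y)
          - ((t y : ℂ) • N.elem y) * A + A * N.elem y * A := fun y => by
      have : ((t y : ℂ) • (1 : Matrix d d ℂ) - A).conjTranspose
          = (t y : ℂ) • (1 : Matrix d d ℂ) - A := by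
        rw [Matrix.conjTranspose_sub, hAh, Matrix.conjTranspose_smul, Matrix.conjTranspose_one]
        simp
      rw [this]
      simp only [sub_mul, mul_sub, Matrix.smul_mul, Matrix.mul_smul, one_mul, mul_one, smul_smul,
        Complex.ofReal_mul, sq]
      abel
    rw [Finset.sum_congr rfl fun y _ => key y]
    simp only [Finset.sum_add_distrib, Finset.sum_sub_distrib]
    rw [← Finset.mul_sum, ← Finset.sum_mul, ← Finset.sum_mul, ← Finset.mul_sum, ← hA,
      N.sum_eq_one, mul_one]
    abel
  rw [e]
  exact Matrix.posSemidef_sum _ fun y _ => (N.posSemidef y).mul_mul_conjTranspose_same _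

/-- Measuring an unnormalized state `W` and a reference state `γ` by the same POVM, the
resolvent-type divergence of the outcome weights is at most that of the states. -/
theorem POVM.sum_sq_div_le (N : POVM Y d) {W γ R : Matrix d d ℂ} (hW : W.PosSemidef)
    (hγ : γ.PosSemidef) {s : ℝ} (hs : 0 < s) (hR : R.IsHermitian)
    (hGR : (γ + (s : ℂ) • 1) * R = 1) (hRG : R * (γ + (s : ℂ) • 1) = 1) :
    ∑ y, (N.elem y * W).trace.re ^ 2
        / (W.trace.re * (N.elem y * γ).trace.re + s * (N.elem y * W).trace.re)
      ≤ (W * R).trace.re := by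
  -- With p the numerator and D the denominator, t = p/D maximizes 2tp - t²D, with value p²/D.
  set t : Y → ℝ := fun y => (N.elem y * W).trace.re
    / (W.trace.re * (N.elem y * γ).trace.re + s * (N.elem y * W).trace.re) with ht
  set A := ∑ y, (t y : ℂ) • N.elem y with hA
  set B := ∑ y, ((t y ^ 2 : ℝ) : ℂ) • N.elem y with hB
  have hAh : A.conjTranspose = A := by
    simp [hA, Matrix.conjTranspose_sum, Matrix.conjTranspose_smul, (N.posSemidef _).isHermitian.eq]
  have lin : ∀ (c : Y → ℝ) (V : Matrix d d ℂ),
      ((∑ y, (c y : ℂ) • N.elem y) * V).trace.re = ∑ y, c y * (N.elem y * V).trace.re :=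
    fun c V => by
      rw [Finset.sum_mul, Matrix.trace_sum, Complex.re_sum]
      refine Finset.sum_congr rfl fun y _ => ?_
      rw [Matrix.smul_mul, Matrix.trace_smul, smul_eq_mul, Complex.re_ofReal_mul]
  have hsum : ∑ y, (N.elem y * W).trace.re ^ 2
        / (W.trace.re * (N.elem y * γ).trace.re + s * (N.elem y * W).trace.re)
      = 2 * (A * W).trace.re - W.trace.re * (B * γ).trace.re - s * (B * W).trace.re := by
    rw [hA, hB, lin, lin, lin, Finset.mul_sum, Finset.mul_sum, Finset.mul_sum,
      ← Finset.sum_sub_distrib, ← Finset.sum_sub_distrib]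
    refine Finset.sum_congr rfl fun y _ => ?_
    simp only [ht]
    generalize hD : W.trace.re * (N.elem y * γ).trace.re + s * (N.elem y * W).trace.re = D
    generalize (N.elem y * W).trace.re = p at hD ⊢
    have : 2 * (p / D * p) - W.trace.re * ((p / D) ^ 2 * (N.elem y * γ).trace.re)
        - s * ((p / D) ^ 2 * p) = 2 * (p / D * p) - (p / D) ^ 2 * D := by
      rw [← hD]; ring
    rw [this]
    -- If D = 0, division by zero gives t = 0 and both sides vanish.
    rcases eq_or_ne D 0 with h | h
    · simp [h]
    · field_simp
      ring
  have hK := N.posSemidef_sum_sq_sub t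
  have h1 := hK.re_trace_mul_nonneg hγ
  have h2 := hK.re_trace_mul_nonneg hW
  have hAγA : (A * γ * A).PosSemidef := by
    have := hγ.mul_mul_conjTranspose_same A
    rwa [hAh] at this
  -- Replaces the scalar Tr W by the operator W, so that every term becomes a trace against W.
  have h3 := hW.re_trace_mul_le hAγA
  have hG : (γ + (s : ℂ) • (1 : Matrix d d ℂ)).PosSemidef :=
    hγ.add (Matrix.PosSemidef.one.smul (Complex.zero_le_real.mpr hs.le))
  -- Completing the square: with G = γ + s and R = G⁻¹, (A - R)G(A - R) ≥ 0 reads 2A - AGA ≤ R.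
  have h4 := hW.re_trace_mul_nonneg (hG.mul_mul_conjTranspose_same (A - R))
  have e4 : (A - R) * (γ + (s : ℂ) • 1) * (A - R).conjTranspose
      = A * γ * A + (s : ℂ) • (A * A) - A - A + R := by
    rw [Matrix.conjTranspose_sub, hAh, hR.eq, sub_mul, hRG, sub_mul, mul_sub, mul_sub,
      Matrix.mul_assoc A _ R, hGR]
    simp only [mul_add, add_mul, Matrix.mul_smul, Matrix.smul_mul, mul_one, one_mul]
    abel
  rw [e4] at h4
  rw [sub_mul, Matrix.trace_sub, Complex.sub_re] at h1 h2
  have e5 : (A * A * γ).trace = (A * γ * A).trace := by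
    rw [Matrix.mul_assoc, Matrix.trace_mul_comm]
  have e6 : (W * (A * A)).trace = (A * A * W).trace := Matrix.trace_mul_comm _ _
  have e7 : (W * A).trace = (A * W).trace := Matrix.trace_mul_comm _ _
  simp only [mul_add, mul_sub, Matrix.mul_smul, Matrix.trace_add, Matrix.trace_sub,
    Matrix.trace_smul, smul_eq_mul, Complex.add_re, Complex.sub_re, Complex.re_ofReal_mul] at h4
  rw [e6, e7] at h4
  rw [e5] at h1
  have hWt : 0 ≤ W.trace.re := (Complex.le_def.mp hW.trace_nonneg).1
  have h5 := mul_nonneg hWt h1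
  have h6 := mul_nonneg hs.le h2
  rw [hsum]
  linarith

end Measurement

/-! ### Scalar inequalities: from resolvents to logarithms, and mutual information. -/

section Scalar

/-- Comparing the resolvent sums of two families of weights compares their logarithmic sums. -/
theorem sum_mul_log_le_of_resolvent_le {ι κ : Type*} [Fintype ι] [Fintype κ]
    {p r : ι → ℝ} {l : κ → ℝ} (hp : ∀ i, 0 ≤ p i) (hp1 : ∑ i, p i = 1)
    (hr : ∀ i, p i ≠ 0 → 0 < r i) (hl : ∀ j, 0 ≤ l j) (hl1 : ∑ j, l j = 1)
    (h : ∀ s : ℝ, 0 < s → ∑ i, p i / (r i + s) ≤ ∑ j, l j / (l j + s)) :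
    ∑ j, l j * Real.log (l j) ≤ ∑ i, p i * Real.log (r i) := by
  set F : ℝ → ℝ := fun s => ∑ j, l j * Real.log (l j + s) - ∑ i, p i * Real.log (r i + s) with hF
  have hd : ∀ (a b s : ℝ), (a ≠ 0 → 0 < b) → 0 ≤ s →
      HasDerivAt (fun s => a * Real.log (b + s)) (a / (b + s)) s := fun a b s hab hs => by
    -- A zero weight makes the function constant, so nothing is needed of b.
    rcases eq_or_ne a 0 with ha | ha
    · simpa [ha] using hasDerivAt_const s (0 : ℝ)
    · have hb : b + s ≠ 0 := (add_pos_of_pos_of_nonneg (hab ha) hs).ne'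
      have := (((hasDerivAt_id s).const_add b).log hb).const_mul a
      simpa [div_eq_mul_inv] using this
  have hl' : ∀ j, l j ≠ 0 → 0 < l j := fun j hj => lt_of_le_of_ne (hl j) hj.symm
  have hFd : ∀ s, 0 ≤ s → HasDerivAt F (∑ j, l j / (l j + s) - ∑ i, p i / (r i + s)) s :=
    fun s hs => (HasDerivAt.fun_sum fun j _ => hd (l j) (l j) s (hl' j) hs).sub
      (HasDerivAt.fun_sum fun i _ => hd (p i) (r i) s (hr i) hs)
  have hmono : MonotoneOn F (Set.Ici 0) := by
    refine monotoneOn_of_deriv_nonneg (convex_Ici 0)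
      (fun s hs => (hFd s hs).continuousAt.continuousWithinAt)
      (fun s hs => ?_) (fun s hs => ?_)
    · rw [interior_Ici] at hs
      exact (hFd s (le_of_lt hs)).differentiableAt.differentiableWithinAt
    · rw [interior_Ici] at hs
      rw [(hFd s (le_of_lt hs)).deriv]
      exact sub_nonneg.mpr (h s hs)
  -- Both families have total weight 1 and each l_j ≤ 1, so F(S) ≤ log(1+S) - log S.
  have hbound : ∀ S : ℝ, 0 < S → F S ≤ 1 / S := fun S hS => by
    have b1 : ∑ j, l j * Real.log (l j + S) ≤ Real.log (1 + S) := by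
      calc _ ≤ ∑ j, l j * Real.log (1 + S) := by
            refine Finset.sum_le_sum fun j _ => mul_le_mul_of_nonneg_left ?_ (hl j)
            refine Real.log_le_log (add_pos_of_nonneg_of_pos (hl j) hS) ?_
            have := Finset.single_le_sum (fun k _ => hl k) (Finset.mem_univ j)
            linarith
        _ = _ := by rw [← Finset.sum_mul, hl1, one_mul]
    have b2 : Real.log S ≤ ∑ i, p i * Real.log (r i + S) := by
      calc Real.log S = ∑ i, p i * Real.log S := by rw [← Finset.sum_mul, hp1, one_mul]
        _ ≤ _ := by
            refine Finset.sum_le_sum fun i _ => ?_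
            rcases eq_or_ne (p i) 0 with h0 | h0
            · simp [h0]
            · refine mul_le_mul_of_nonneg_left (Real.log_le_log hS ?_) (hp i)
              linarith [hr i h0]
    have b3 : Real.log (1 + S) - Real.log S ≤ 1 / S := by
      rw [← Real.log_div (by positivity) hS.ne']
      refine (Real.log_le_sub_one_of_pos (by positivity)).trans (le_of_eq ?_)
      field_simp
      ring
    simp only [hF]
    linarith
  have h0 : F 0 ≤ 0 := by
    refine le_of_forall_pos_le_add fun ε hε => ?_
    have hi : 0 < 1 / ε := by positivity
    have := (hmono (Set.mem_Ici.mpr le_rfl) (Set.mem_Ici.mpr hi.le) hi.le).trans (hbound _ hi)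
    simpa using this
  simp only [hF, add_zero] at h0
  linarith

variable {X Y : Type*} [Fintype X] [Fintype Y]

/-- Mutual information as a relative entropy. -/
theorem mutualInformation_eq_neg_sum {p : X × Y → ℝ} (hp : ∀ q, 0 ≤ p q) :
    mutualInformation p = -(∑ q : X × Y, p q *
      Real.log ((∑ y, p (q.1, y)) * (∑ x, p (x, q.2)) / p q)) / Real.log 2 := by
  have hX : ∑ x, (∑ y, p (x, y)) * Real.logb 2 (∑ y, p (x, y))
      = ∑ q : X × Y, p q * Real.logb 2 (∑ y, p (q.1, y)) := by
    rw [Fintype.sum_prod_type]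
    exact Finset.sum_congr rfl fun x _ => Finset.sum_mul _ _ _
  have hY : ∑ y, (∑ x, p (x, y)) * Real.logb 2 (∑ x, p (x, y))
      = ∑ q : X × Y, p q * Real.logb 2 (∑ x, p (x, q.2)) := by
    rw [Fintype.sum_prod_type_right]
    exact Finset.sum_congr rfl fun y _ => Finset.sum_mul _ _ _
  simp only [mutualInformation, shannonEntropy]
  rw [hX, hY, neg_div, Finset.sum_div, ← neg_add, ← Finset.sum_add_distrib, sub_neg_eq_add,
    neg_add_eq_sub, ← neg_sub, ← Finset.sum_sub_distrib]
  congr 1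
  refine Finset.sum_congr rfl fun q _ => ?_
  rcases eq_or_ne (p q) 0 with h0 | h0
  · simp [h0]
  · have hq : 0 < p q := lt_of_le_of_ne (hp q) h0.symm
    have h1 : 0 < ∑ y, p (q.1, y) := lt_of_lt_of_le hq
      (Finset.single_le_sum (f := fun y => p (q.1, y)) (fun y _ => hp _) (Finset.mem_univ q.2))
    have h2 : 0 < ∑ x, p (x, q.2) := lt_of_lt_of_le hq
      (Finset.single_le_sum (f := fun x => p (x, q.2)) (fun x _ => hp _) (Finset.mem_univ q.1))
    rw [Real.log_div (mul_pos h1 h2).ne' h0, Real.log_mul h1.ne' h2.ne']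
    simp only [Real.logb]
    ring

/-- Mutual information of a probability distribution is nonnegative. -/
theorem mutualInformation_nonneg {p : X × Y → ℝ} (hp : p ∈ stdSimplex ℝ (X × Y)) :
    0 ≤ mutualInformation p := by
  rw [mutualInformation_eq_neg_sum hp.1]
  refine div_nonneg (neg_nonneg.mpr ?_) (Real.log_nonneg one_le_two)
  have hs : ∑ q : X × Y, (∑ y, p (q.1, y)) * (∑ x, p (x, q.2)) = 1 := by
    have h1 := hp.2
    have h2 := hp.2
    rw [Fintype.sum_prod_type] at h1
    rw [Fintype.sum_prod_type_right] at h2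
    rw [Fintype.sum_prod_type]
    simp only
    rw [← Finset.sum_mul_sum, h1, h2, one_mul]
  calc _ ≤ ∑ q : X × Y, ((∑ y, p (q.1, y)) * (∑ x, p (x, q.2)) - p q) := by
        refine Finset.sum_le_sum fun q _ => ?_
        have hX : 0 ≤ ∑ y, p (q.1, y) := Finset.sum_nonneg fun y _ => hp.1 _
        have hY : 0 ≤ ∑ x, p (x, q.2) := Finset.sum_nonneg fun x _ => hp.1 _
        rcases eq_or_ne (p q) 0 with h0 | h0
        -- Where p vanishes the logarithmic term is 0, and p_X p_Y ≥ 0 remains on the right.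
        · simpa [h0] using mul_nonneg hX hY
        · have hq : 0 < p q := lt_of_le_of_ne (hp.1 q) h0.symm
          have h1 : p q ≤ ∑ y, p (q.1, y) := Finset.single_le_sum
            (f := fun y => p (q.1, y)) (fun y _ => hp.1 _) (Finset.mem_univ q.2)
          have h2 : p q ≤ ∑ x, p (x, q.2) := Finset.single_le_sum
            (f := fun x => p (x, q.2)) (fun x _ => hp.1 _) (Finset.mem_univ q.1)
          have hpos := mul_pos (hq.trans_le h1) (hq.trans_le h2)
          have := mul_le_mul_of_nonneg_left
            (Real.log_le_sub_one_of_pos (div_pos hpos hq)) hq.le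
          rwa [mul_sub, mul_div_cancel₀ _ h0, mul_one] at this
    _ = 0 := by rw [Finset.sum_sub_distrib, hs, hp.2, sub_self]

end Scalar

/-! ### Application to the retrodictive joint distribution. -/

section Retrodiction

variable {d X Y : Type*} [Fintype d] [DecidableEq d] [Fintype X] [Fintype Y]

theorem retroJoint_marginal_right (γ : QState d) (M : POVM X d) (N : POVM Y d) (y : Y) :
    ∑ x, retroJoint γ M N (x, y) = (N.elem y * γ.mat).trace.re := by
  simp only [retroJoint_symm γ M N]
  exact retroJoint_marginal γ N M y

theorem retroJoint_eq_trace_mul (γ : QState d) (M : POVM X d) (N : POVM Y d) (x : X) (y : Y) :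
    retroJoint γ M N (x, y)
      = (N.elem y * (CFC.sqrt γ.mat * M.elem x * CFC.sqrt γ.mat)).trace.re := by
  simp only [retroJoint, Matrix.mul_assoc]

/-- The resolvent comparison between the joint distribution and the spectrum of the state. -/
theorem retroJoint_resolvent_le (γ : QState d) (M : POVM X d) (N : POVM Y d) {s : ℝ}
    (hs : 0 < s) :
    ∑ q : X × Y, retroJoint γ M N q / ((∑ y, retroJoint γ M N (q.1, y))
        * (∑ x, retroJoint γ M N (x, q.2)) / retroJoint γ M N q + s)
      ≤ ∑ i, γ.posSemidef.isHermitian.eigenvalues i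
          / (γ.posSemidef.isHermitian.eigenvalues i + s) := by
  obtain ⟨R, hR, hGR, hRG, htr⟩ := γ.posSemidef.exists_resolvent hs
  have hsq : (CFC.sqrt γ.mat).conjTranspose = CFC.sqrt γ.mat :=
    (Matrix.nonneg_iff_posSemidef.mp (CFC.sqrt_nonneg γ.mat)).isHermitian
  set W : X → Matrix d d ℂ := fun x => CFC.sqrt γ.mat * M.elem x * CFC.sqrt γ.mat with hW
  have hWpos : ∀ x, (W x).PosSemidef := fun x => by
    have := (M.posSemidef x).mul_mul_conjTranspose_same (CFC.sqrt γ.mat)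
    rwa [hsq] at this
  have hWsum : ∑ x, W x = γ.mat := by
    simp only [hW]
    rw [← Finset.sum_mul, ← Finset.mul_sum, M.sum_eq_one, mul_one, γ.sqrt_mul_sqrt]
  have hWtr : ∀ x, ∑ y, retroJoint γ M N (x, y) = (W x).trace.re := fun x => by
    simp only [retroJoint_eq_trace_mul]
    rw [← Complex.re_sum, ← Matrix.trace_sum, ← Finset.sum_mul, N.sum_eq_one, one_mul]
  rw [← htr, Fintype.sum_prod_type]
  calc _ = ∑ x, ∑ y, (N.elem y * W x).trace.re ^ 2 / ((W x).trace.re *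
          (N.elem y * γ.mat).trace.re + s * (N.elem y * W x).trace.re) := by
        refine Finset.sum_congr rfl fun x _ => Finset.sum_congr rfl fun y _ => ?_
        simp only [hWtr, retroJoint_marginal_right]
        rw [retroJoint_eq_trace_mul]
        -- Multiplying p/(r+s) through by p gives p²/(p_X p_Y + s p); for p = 0 both sides are 0.
        rcases eq_or_ne (N.elem y * W x).trace.re 0 with h0 | h0
        · simp only [hW] at h0
          simp [hW, h0]
        · simp only [hW] at h0 ⊢
          rw [div_add' _ _ _ h0, div_div_eq_mul_div, sq]
    _ ≤ ∑ x, (W x * R).trace.re := Finset.sum_le_sum fun x _ =>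
        N.sum_sq_div_le (hWpos x) γ.posSemidef hs hR hGR hRG
    _ = _ := by rw [← Complex.re_sum, ← Matrix.trace_sum, ← Finset.sum_mul, hWsum]

end Retrodiction

theorem mainTheorem2 {d X Y : Type*} [Fintype d] [DecidableEq d] [Fintype X] [Fintype Y]
    (γ : QState d) (M : POVM X d) (N : POVM Y d) :
    0 ≤ mutualRetrodictability γ M N ∧
      mutualRetrodictability γ M N ≤ vonNeumannEntropy γ := by
  have hp := retroJoint_mem_stdSimplex γ M N
  refine ⟨mutualInformation_nonneg hp, ?_⟩
  have hl1 : ∑ i, γ.posSemidef.isHermitian.eigenvalues i = 1 := by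
    have h := γ.posSemidef.isHermitian.trace_eq_sum_eigenvalues
    rw [γ.trace_eq_one] at h
    have := congrArg Complex.re h
    simpa using this.symm
  -- The remaining side goal is r > 0 on the support of p, where both marginals dominate p.
  have key := sum_mul_log_le_of_resolvent_le hp.1 hp.2 (fun q h0 => ?_)
    γ.posSemidef.eigenvalues_nonneg hl1 (fun s hs => retroJoint_resolvent_le γ M N hs)
  · rw [mutualRetrodictability, mutualInformation_eq_neg_sum hp.1, vonNeumannEntropy,
      shannonEntropy]
    simp only [Real.logb, ← mul_div_assoc]
    rw [← Finset.sum_div, ← neg_div]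
    exact div_le_div_of_nonneg_right (neg_le_neg key) (Real.log_nonneg one_le_two)
  · have hq : 0 < retroJoint γ M N q := lt_of_le_of_ne (hp.1 q) h0.symm
    refine div_pos (mul_pos (hq.trans_le ?_) (hq.trans_le ?_)) hq
    · exact Finset.single_le_sum (f := fun y => retroJoint γ M N (q.1, y))
        (fun y _ => hp.1 _) (Finset.mem_univ q.2)
    · exact Finset.single_le_sum (f := fun x => retroJoint γ M N (x, q.2))
        (fun x _ => hp.1 _) (Finset.mem_univ q.1)
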